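/- For an integer $a\ge 0$ let ${}^{1}a=a$ and ${}^{b}a=a^{({}^{b-1}a)}$ for $b\ge 2$. For $a\ge 2$ not a multiple of $10$, let $s(a,0)=0$ and, for $b\ge 1$, let $s(a,b)$ be the integer $n\ge 0$ with ${}^{b}a\equiv{}^{b+1}a\pmod{10^{n}}$ and ${}^{b}a\not\equiv{}^{b+1}a\pmod{10^{n+1}}$; the congruence speed of $a$ at height $b\ge 1$ is $V(a,b)=s(a,b)-s(a,b-1)$. By convention $V(0,b)=0$ for all $b\ge1$, $V(1,1)=1$, and $V(1,b)=0$ for all $b\ge 2$. The constant congruence speed of $a$ is $V(a)=V(a,\bar b)$, where $\bar b$ is the least $b\ge 1$ such that $V(a,b)=V(a,b+k)$ for all $k\ge 0$. For a prime $p$ let $v_p$ denote the $p$-adic valuation. **Theorem.** Let $a\ge 0$ be an integer such that $a=0$ or $a$ is not a multiple of $10$. Then $\bar b$ exists (so that $V(a)$ is defined), and $$ V(a)=\begin{cases} 0 & \text{if } a\in\{0,1\},\\ \min\{v_2(a-1),\,v_5(a-1)\} & \text{if } a\equiv 1\pmod{100},\ a\ne 1,\\ \min\{v_2(a+1),\,v_5(a-1)\}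 & \text{if } a\equiv 51\pmod{100},\\ v_5(a^2+1) & \text{if } a\equiv 2 \text{ or } 8\pmod{10},\\ \min\{v_2(a+1),\,v_5(a^2+1)\} & \text{if } a\equiv 7\text{ or }43\pmod{100},\\ \min\{v_2(a-1),\,v_5(a^2+1)\} & \text{if } a\equiv 57\text{ or }93\pmod{100},\\ v_5(a+1) & \text{if } a\equiv 4\pmod{10},\\ v_2(a^2-1)-1 & \text{if } a\equiv 5\pmod{10},\\ v_5(a-1) & \text{if } a\equiv 6\pmod{10},\\ \min\{v_2(a-1),\,v_5(a+1)\} & \text{if } a\equiv 49\pmod{100},\\ \min\{v_2(a+1),\,v_5(a+1)\} & \text{if } a\equiv 99\pmod{100},\\ 1 & \text{otherwise.} \end{cases} $$ -/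

import Mathlib

/-- The integer tetration `ᵇa`: `¹a = a` and `ᵇa = a ^ (ᵇ⁻¹a)` for `b ≥ 2`.  The value `1` at height
`0` only serves to start the recursion. -/
def tetration (a : ℕ) : ℕ → ℕ
  | 0 => 1
  | b + 1 => a ^ tetration a b

theorem tetration_one (a : ℕ) : tetration a 1 = a := by simp [tetration]

theorem tetration_succ (a b : ℕ) : tetration a (b + 1) = a ^ tetration a b := rfl

/-- The decimal expansions of `x` and `y` agree on exactly their `n` last digits. -/
def AgreeExactly (x y n : ℕ) : Prop :=
  x ≡ y [MOD 10 ^ n] ∧ ¬ x ≡ y [MOD 10 ^ (n + 1)]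

theorem AgreeExactly.unique {x y m n : ℕ} (hm : AgreeExactly x y m) (hn : AgreeExactly x y n) :
    m = n := by
  rcases lt_trichotomy m n with h | h | h
  · exact absurd (hn.1.of_dvd (pow_dvd_pow 10 h)) hm.2
  · exact h
  · exact absurd (hm.1.of_dvd (pow_dvd_pow 10 h)) hn.2

/-- `n` is the number of last digits that are common to `ᵇa` and `ᵇ⁺¹a`; at height `b = 0`, below
the first tetration `¹a = a`, no digit counts as stable. -/
def IsStableCount (a b n : ℕ) : Prop :=
  if b = 0 then n = 0 else AgreeExactly (tetration a b) (tetration a (b + 1)) n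

theorem IsStableCount.unique {a b m n : ℕ} (hm : IsStableCount a b m) (hn : IsStableCount a b n) :
    m = n := by
  unfold IsStableCount at hm hn
  split_ifs at hm hn with h
  · exact hm.trans hn.symm
  · exact hm.unique hn

/-- `v` is the number of new stable digits that are gained at height `b`: if exactly `n` last digits
are common to `ᵇ⁻¹a` and `ᵇa`, then exactly `n + v` last digits are common to `ᵇa` and `ᵇ⁺¹a`. -/
def IsCongruenceSpeed (a b v : ℕ) : Prop :=
  ∃ n : ℕ, IsStableCount a (b - 1) n ∧ IsStableCount a b (n + v)

theorem IsCongruenceSpeed.unique {a b v w : ℕ} (hv : IsCongruenceSpeed a b v)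
    (hw : IsCongruenceSpeed a b w) : v = w := by
  obtain ⟨m, hm, hm'⟩ := hv
  obtain ⟨n, hn, hn'⟩ := hw
  have h1 := hm.unique hn
  have h2 := hm'.unique hn'
  omega

/-- The congruence speed `V(a, b)` of the base `a` at height `b ≥ 1`.  For `a ≥ 2` it is the unique
`v` with `IsCongruenceSpeed a b v`.  For the degenerate bases, `V(0, b) = 0` for all `b`,
`V(1, 1) = 1`, and `V(1, b) = 0` for `b ≥ 2`. -/
noncomputable def congruenceSpeed (a b : ℕ) : ℕ :=
  if a = 0 then 0
  else if a = 1 then (if b = 1 then 1 else 0)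
  else sInf {v : ℕ | IsCongruenceSpeed a b v}

theorem IsCongruenceSpeed.congruenceSpeed_eq {a b v : ℕ} (ha : 2 ≤ a)
    (h : IsCongruenceSpeed a b v) : congruenceSpeed a b = v := by
  have hs : {w : ℕ | IsCongruenceSpeed a b w} = {v} :=
    Set.eq_singleton_iff_unique_mem.2 ⟨h, fun _ hw => IsCongruenceSpeed.unique hw h⟩
  have h0 : a ≠ 0 := by omega
  have h1 : a ≠ 1 := by omega
  rw [congruenceSpeed, if_neg h0, if_neg h1, hs, csInf_singleton]

/-- From the height `b ≥ 1` on, the congruence speed of `a` is constant. -/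
def SpeedConstantFrom (a b : ℕ) : Prop :=
  1 ≤ b ∧ ∀ k : ℕ, congruenceSpeed a b = congruenceSpeed a (b + k)

/-- The smallest height from which the congruence speed of `a` is constant. -/
noncomputable def minConstantHeight (a : ℕ) : ℕ :=
  sInf {b : ℕ | SpeedConstantFrom a b}

/-- The constant congruence speed `V(a)`. -/
noncomputable def constantCongruenceSpeed (a : ℕ) : ℕ :=
  congruenceSpeed a (minConstantHeight a)

/-! Write `D b` for the gap between heights `b` and `b + 1`, and `T b` for the tetration. The number
of stable digits is the minimum of the 2-adic and 5-adic valuations of `D b`, and `D (b + 1) = T (b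
+ 1) * (a ^ D b - 1)`. For `p ∈ {2, 5}` with `p ∤ a`, lifting the exponent shows that `v_p (D b)`
eventually grows by a constant: `v_5 (a ^ 4 - 1)` or `v_2 (a + 1) + v_2 (a - 1) - 1`. If `p ∣ a`, it
is at least exponential in `b` and eventually plays no part in the minimum. So the speed is
eventually the smaller of the relevant constants, which residues mod 100 make explicit. -/

/-! ### Minima of eventually arithmetic sequences -/

theorem mul_add_le_two_pow (K c : ℕ) : ∃ M, ∀ b, M ≤ b → K + c * b ≤ 2 ^ b := by
  refine ⟨K + c + 4, fun b hb => ?_⟩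
  have h1 : K + c * b ≤ b ^ 2 := by
    obtain ⟨d, rfl⟩ := Nat.exists_eq_add_of_le hb
    nlinarith [Nat.zero_le (K * c), Nat.zero_le (K * d), Nat.zero_le (c * d), Nat.zero_le (K * K)]
  have h2 : ∀ n : ℕ, 4 ≤ n → n ^ 2 ≤ 2 ^ n := by
    intro n hn
    induction n, hn using Nat.le_induction with
    | base => norm_num
    | succ n hn ih => rw [pow_succ 2]; nlinarith
  exact h1.trans (h2 b (by omega))

theorem eq_add_mul_of_arithmetic {u : ℕ → ℕ} {N α : ℕ} (hu : ∀ b, N ≤ b → u (b + 1) = u b + α)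
    (k : ℕ) : u (N + k) = u N + k * α := by
  induction k with
  | zero => simp
  | succ k ih => rw [← add_assoc, hu _ (by omega), ih]; ring

theorem eventually_le_of_arithmetic_of_two_pow_le {u w : ℕ → ℕ} {N α : ℕ}
    (hu : ∀ b, N ≤ b → u (b + 1) = u b + α) (hw : ∀ b, N ≤ b → 2 ^ b ≤ w (b + 1)) :
    ∃ M, ∀ b, M ≤ b → u b ≤ w b := by
  obtain ⟨M, hM⟩ := mul_add_le_two_pow (u N + α) α
  refine ⟨M + N + 1, fun b hb => ?_⟩
  obtain ⟨k, rfl⟩ := Nat.exists_eq_add_of_le (show N + 1 ≤ b by omega)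
  have h1 := eq_add_mul_of_arithmetic hu (k + 1)
  have h2 := hM (N + k) (by omega)
  have h3 := hw (N + k) (by omega)
  rw [show N + 1 + k = N + (k + 1) by ring, h1]
  have : (k + 1) * α ≤ α + α * (N + k) := by nlinarith [Nat.zero_le (α * N)]
  have h4 : 2 ^ (N + k) ≤ w (N + (k + 1)) := h3
  omega

theorem eventually_le_of_arithmetic_of_lt {u w : ℕ → ℕ} {N α β : ℕ}
    (hu : ∀ b, N ≤ b → u (b + 1) = u b + α) (hw : ∀ b, N ≤ b → w (b + 1) = w b + β)
    (h : α < β) : ∃ M, ∀ b, M ≤ b → u b ≤ w b := by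
  -- `w` gains at least one on `u` per step, so `u N` steps suffice to catch up.
  refine ⟨N + u N, fun b hb => ?_⟩
  obtain ⟨k, rfl⟩ := Nat.exists_eq_add_of_le (show N ≤ b by omega)
  rw [eq_add_mul_of_arithmetic hu, eq_add_mul_of_arithmetic hw]
  have : k * (α + 1) ≤ k * β := Nat.mul_le_mul_left k h
  have : k * (α + 1) = k * α + k := by ring
  omega

theorem eventually_min_arithmetic {u w : ℕ → ℕ} {N α β : ℕ}
    (hu : ∀ b, N ≤ b → u (b + 1) = u b + α) (hw : ∀ b, N ≤ b → w (b + 1) = w b + β) :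
    ∃ M, ∀ b, M ≤ b → min (u (b + 1)) (w (b + 1)) = min (u b) (w b) + min α β := by
  rcases lt_trichotomy α β with h | rfl | h
  · obtain ⟨M, hM⟩ := eventually_le_of_arithmetic_of_lt hu hw h
    refine ⟨M + N, fun b hb => ?_⟩
    have := hM b (by omega)
    have := hM (b + 1) (by omega)
    have := hu b (by omega)
    omega
  · refine ⟨N, fun b hb => ?_⟩
    have := hu b hb
    have := hw b hb
    omega
  · obtain ⟨M, hM⟩ := eventually_le_of_arithmetic_of_lt hw hu h
    refine ⟨M + N, fun b hb => ?_⟩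
    have := hM b (by omega)
    have := hM (b + 1) (by omega)
    have := hw b (by omega)
    omega

theorem eventually_min_arithmetic_of_two_pow_le {u w : ℕ → ℕ} {N α : ℕ}
    (hu : ∀ b, N ≤ b → u (b + 1) = u b + α) (hw : ∀ b, N ≤ b → 2 ^ b ≤ w (b + 1)) :
    ∃ M, ∀ b, M ≤ b → min (u (b + 1)) (w (b + 1)) = min (u b) (w b) + α := by
  obtain ⟨M, hM⟩ := eventually_le_of_arithmetic_of_two_pow_le hu hw
  refine ⟨M + N, fun b hb => ?_⟩
  have := hM b (by omega)
  have := hM (b + 1) (by omega)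
  have := hu b (by omega)
  omega

/-! ### The gap and its valuations -/

/-- The difference of two consecutive tetrations of `a`. -/
def tetrationGap (a b : ℕ) : ℕ := tetration a (b + 1) - tetration a b

theorem tetration_lt_succ {a : ℕ} (ha : 2 ≤ a) (b : ℕ) : tetration a b < tetration a (b + 1) :=
  Nat.lt_pow_self (by omega)

theorem tetrationGap_ne_zero {a : ℕ} (ha : 2 ≤ a) (b : ℕ) : tetrationGap a b ≠ 0 :=
  (Nat.sub_pos_of_lt (tetration_lt_succ ha b)).ne'

theorem two_pow_le_tetration {a : ℕ} (ha : 2 ≤ a) {b : ℕ} (hb : 1 ≤ b) :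
    2 ^ b ≤ tetration a b := by
  induction b, hb using Nat.le_induction with
  | base => simpa [tetration_one] using ha
  | succ b hb ih =>
    have h : b + 1 ≤ tetration a b := (Nat.lt_two_pow_self (n := b)).trans_le ih
    exact (Nat.pow_le_pow_left ha _).trans (Nat.pow_le_pow_right (by omega) h)

theorem tetrationGap_succ {a : ℕ} (ha : 2 ≤ a) (b : ℕ) :
    tetrationGap a (b + 1) = tetration a (b + 1) * (a ^ tetrationGap a b - 1) := by
  have h : tetration a (b + 1) = tetration a b + tetrationGap a b := by
    have := tetration_lt_succ ha b
    unfold tetrationGap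
    omega
  rw [tetrationGap, tetration_succ a (b + 1), Nat.mul_sub_one, h, pow_add, ← tetration_succ, ← h]

theorem pow_tetrationGap_sub_one_ne_zero {a : ℕ} (ha : 2 ≤ a) (b : ℕ) :
    a ^ tetrationGap a b - 1 ≠ 0 :=
  (Nat.sub_pos_of_lt (Nat.one_lt_pow (tetrationGap_ne_zero ha b) (by omega))).ne'

theorem tetration_pos {a : ℕ} (ha : 2 ≤ a) (b : ℕ) : 0 < tetration a b := by
  cases b with
  | zero => simp [tetration]
  | succ b => exact pow_pos (by omega) _

theorem padicValNat_tetrationGap_succ {p a : ℕ} [Fact p.Prime] (ha : 2 ≤ a) (b : ℕ) :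
    padicValNat p (tetrationGap a (b + 1)) =
      tetration a b * padicValNat p a + padicValNat p (a ^ tetrationGap a b - 1) := by
  rw [tetrationGap_succ ha, padicValNat.mul (tetration_pos ha _).ne'
    (pow_tetrationGap_sub_one_ne_zero ha b), tetration_succ, padicValNat.pow]

theorem two_pow_le_padicValNat_tetrationGap {p a : ℕ} [Fact p.Prime] (ha : 2 ≤ a) (hp : p ∣ a)
    {b : ℕ} (hb : 1 ≤ b) : 2 ^ b ≤ padicValNat p (tetrationGap a (b + 1)) := by
  rw [padicValNat_tetrationGap_succ ha]
  have h1 : 1 ≤ padicValNat p a := one_le_padicValNat_of_dvd (by omega) hp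
  exact ((two_pow_le_tetration ha hb).trans (Nat.le_mul_of_pos_right _ h1)).trans
    (Nat.le_add_right _ _)

/-! ### Lifting the exponent at 5 and 2 -/

theorem four_dvd_pow_sub_one {a n : ℕ} (ha : a % 2 = 1) (hn : 2 ∣ n) : 4 ∣ a ^ n - 1 := by
  obtain ⟨m, rfl⟩ := hn
  refine (Nat.modEq_iff_dvd' (Nat.one_le_pow _ _ (by omega))).1 ?_
  have h : a ^ 2 ≡ 1 [MOD 4] := by
    have : a % 4 = 1 ∨ a % 4 = 3 := by omega
    rcases this with h | h <;> simp [Nat.ModEq, Nat.pow_mod, h]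
  rw [pow_mul]
  simpa using (h.pow m).symm

/-- By Fermat `5 ∣ a ^ 4 - 1`, so lifting the exponent applies to the base `a ^ 4`; the factor 4 of
`n` is invisible to 5. -/
theorem padicValNat_five_pow_sub_one {a n : ℕ} (ha : 2 ≤ a) (h5 : ¬ 5 ∣ a) (hn : n ≠ 0)
    (h4 : 4 ∣ n) : padicValNat 5 (a ^ n - 1) = padicValNat 5 n + padicValNat 5 (a ^ 4 - 1) := by
  have : Fact (Nat.Prime 5) := ⟨by norm_num⟩
  obtain ⟨m, rfl⟩ := h4
  have h1 : 1 < a ^ 4 := Nat.one_lt_pow (by norm_num) (by omega)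
  have h2 : 5 ∣ a ^ 4 - 1 := by
    refine (Nat.modEq_iff_dvd' h1.le).1 ?_
    have : a % 5 = 1 ∨ a % 5 = 2 ∨ a % 5 = 3 ∨ a % 5 = 4 := by omega
    rcases this with h | h | h | h <;> simp [Nat.ModEq, Nat.pow_mod, h]
  have h3 : ¬ 5 ∣ a ^ 4 := fun h => h5 (Nat.Prime.dvd_of_dvd_pow (by norm_num) h)
  have h := padicValNat.pow_sub_pow (p := 5) (by decide) h1 h2 h3 (n := m) (by omega)
  rw [one_pow, ← pow_mul] at h
  rw [h, padicValNat.mul (by norm_num) (by omega),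
    padicValNat.eq_zero_of_not_dvd (show ¬ 5 ∣ 4 by norm_num)]
  ring

theorem padicValNat_two_pow_sub_one {a n : ℕ} (ha : 2 ≤ a) (h2 : a % 2 = 1) (hn : n ≠ 0)
    (hn2 : 2 ∣ n) : padicValNat 2 (a ^ n - 1) =
      padicValNat 2 n + (padicValNat 2 (a + 1) + padicValNat 2 (a - 1) - 1) := by
  have h := padicValNat.pow_two_sub_pow (x := a) (y := 1) (by omega) (by omega) (by omega) hn
    (even_iff_two_dvd.2 hn2)
  rw [one_pow] at h
  have : 1 ≤ padicValNat 2 (a + 1) := one_le_padicValNat_of_dvd (by omega) (by omega)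
  omega

/-! ### From valuations to the congruence speed -/

theorem agreeExactly_min_padicValNat {x y : ℕ} (h : x < y) :
    AgreeExactly x y (min (padicValNat 2 (y - x)) (padicValNat 5 (y - x))) := by
  have : Fact (Nat.Prime 5) := ⟨by norm_num⟩
  have hd : ∀ n, x ≡ y [MOD 10 ^ n] ↔ n ≤ padicValNat 2 (y - x) ∧ n ≤ padicValNat 5 (y - x) := by
    intro n
    have h0 : y - x ≠ 0 := by omega
    rw [Nat.modEq_iff_dvd' h.le, show (10 : ℕ) = 2 * 5 by norm_num, mul_pow,
      ← padicValNat_dvd_iff_le h0, ← padicValNat_dvd_iff_le h0]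
    have hc : Nat.Coprime (2 ^ n) (5 ^ n) := Nat.Coprime.pow _ _ (by norm_num)
    exact ⟨fun h => ⟨dvd_of_mul_right_dvd h, dvd_of_mul_left_dvd h⟩,
      fun h => hc.mul_dvd_of_dvd_of_dvd h.1 h.2⟩
  constructor
  · rw [hd]; omega
  · rw [hd]; omega

theorem congruenceSpeed_eventually_eq {a c N : ℕ} (ha : 2 ≤ a)
    (h : ∀ b, N ≤ b →
      min (padicValNat 5 (tetrationGap a (b + 1))) (padicValNat 2 (tetrationGap a (b + 1))) =
        min (padicValNat 5 (tetrationGap a b)) (padicValNat 2 (tetrationGap a b)) + c) :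
    ∃ M, ∀ b, M ≤ b → congruenceSpeed a b = c := by
  -- The height `b - 1` must also be positive, since the count at height 0 is set by convention.
  refine ⟨N + 2, fun b hb => IsCongruenceSpeed.congruenceSpeed_eq ha ?_⟩
  obtain ⟨d, rfl⟩ := Nat.exists_eq_add_of_le' (show 1 ≤ b by omega)
  have key : ∀ e, 1 ≤ e → IsStableCount a e
      (min (padicValNat 5 (tetrationGap a e)) (padicValNat 2 (tetrationGap a e))) := by
    intro e he
    rw [IsStableCount, if_neg (by omega), min_comm]
    exact agreeExactly_min_padicValNat (tetration_lt_succ ha e)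
  refine ⟨_, key d (by omega), ?_⟩
  rw [← h d (by omega)]
  exact key (d + 1) (by omega)

theorem exists_speedConstantFrom_and_eq {a c M : ℕ}
    (h : ∀ b, M ≤ b → congruenceSpeed a b = c) :
    (∃ b, SpeedConstantFrom a b) ∧ constantCongruenceSpeed a = c := by
  have hne : ∃ b, SpeedConstantFrom a b :=
    ⟨M + 1, by omega, fun k => by rw [h _ (by omega), h _ (by omega)]⟩
  refine ⟨hne, ?_⟩
  have hm : SpeedConstantFrom a (minConstantHeight a) := Nat.sInf_mem hne
  rw [constantCongruenceSpeed, hm.2 M, h _ (by omega)]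

/-- Supplies the divisibility of the exponent needed for both lifting lemmas. It can fail at height
1: for `a = 2` the gap is 2. -/
theorem four_dvd_tetrationGap {a b : ℕ} (ha : 2 ≤ a) (hb : 2 ≤ b) : 4 ∣ tetrationGap a b := by
  obtain ⟨c, rfl⟩ := Nat.exists_eq_add_of_le' (show 1 ≤ b by omega)
  rw [tetrationGap_succ ha]
  rcases Nat.mod_two_eq_zero_or_one a with h | h
  · refine Dvd.dvd.mul_right ?_ _
    have h1 := two_pow_le_tetration ha (show 1 ≤ c by omega)
    have h2 : 2 ≤ tetration a c := by
      have : 2 ^ 1 ≤ 2 ^ c := Nat.pow_le_pow_right (by norm_num) (by omega)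
      omega
    calc 4 = 2 ^ 2 := by norm_num
      _ ∣ a ^ 2 := pow_dvd_pow_of_dvd (Nat.dvd_of_mod_eq_zero h) 2
      _ ∣ a ^ tetration a c := pow_dvd_pow a h2
  · refine Dvd.dvd.mul_left (four_dvd_pow_sub_one h ?_) _
    have hodd : ∀ e, tetration a e % 2 = 1 := by
      intro e
      cases e with
      | zero => rfl
      | succ e => rw [tetration_succ, Nat.pow_mod, h]; simp
    have h1 := hodd c
    have h2 := hodd (c + 1)
    unfold tetrationGap
    omega

theorem padicValNat_five_tetrationGap_succ {a b : ℕ} (ha : 2 ≤ a) (h5 : ¬ 5 ∣ a) (hb : 2 ≤ b) :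
    padicValNat 5 (tetrationGap a (b + 1)) =
      padicValNat 5 (tetrationGap a b) + padicValNat 5 (a ^ 4 - 1) := by
  have : Fact (Nat.Prime 5) := ⟨by norm_num⟩
  rw [padicValNat_tetrationGap_succ ha, padicValNat.eq_zero_of_not_dvd h5, mul_zero, zero_add,
    padicValNat_five_pow_sub_one ha h5 (tetrationGap_ne_zero ha b) (four_dvd_tetrationGap ha hb)]

theorem padicValNat_two_tetrationGap_succ {a b : ℕ} (ha : 2 ≤ a) (h2 : a % 2 = 1) (hb : 2 ≤ b) :
    padicValNat 2 (tetrationGap a (b + 1)) =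
      padicValNat 2 (tetrationGap a b) + (padicValNat 2 (a + 1) + padicValNat 2 (a - 1) - 1) := by
  rw [padicValNat_tetrationGap_succ ha, padicValNat.eq_zero_of_not_dvd (by omega), mul_zero,
    zero_add, padicValNat_two_pow_sub_one ha h2 (tetrationGap_ne_zero ha b)
      (dvd_trans (by norm_num) (four_dvd_tetrationGap ha hb))]

theorem congruenceSpeed_eventually_of_even {a : ℕ} (ha : 2 ≤ a) (h2 : 2 ∣ a) (h5 : ¬ 5 ∣ a) :
    ∃ M, ∀ b, M ≤ b → congruenceSpeed a b = padicValNat 5 (a ^ 4 - 1) := by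
  obtain ⟨M, hM⟩ := eventually_min_arithmetic_of_two_pow_le (N := 2)
    (u := fun b => padicValNat 5 (tetrationGap a b))
    (w := fun b => padicValNat 2 (tetrationGap a b))
    (fun b hb => padicValNat_five_tetrationGap_succ ha h5 hb)
    (fun b hb => two_pow_le_padicValNat_tetrationGap ha h2 (by omega))
  exact congruenceSpeed_eventually_eq ha hM

theorem congruenceSpeed_eventually_of_five_dvd {a : ℕ} (ha : 2 ≤ a) (h2 : a % 2 = 1)
    (h5 : 5 ∣ a) : ∃ M, ∀ b, M ≤ b →
      congruenceSpeed a b = padicValNat 2 (a + 1) + padicValNat 2 (a - 1) - 1 := by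
  have : Fact (Nat.Prime 5) := ⟨by norm_num⟩
  obtain ⟨M, hM⟩ := eventually_min_arithmetic_of_two_pow_le (N := 2)
    (u := fun b => padicValNat 2 (tetrationGap a b))
    (w := fun b => padicValNat 5 (tetrationGap a b))
    (fun b hb => padicValNat_two_tetrationGap_succ ha h2 hb)
    (fun b hb => two_pow_le_padicValNat_tetrationGap ha h5 (by omega))
  exact congruenceSpeed_eventually_eq ha fun b hb => by
    rw [min_comm, min_comm (padicValNat 5 _)]
    exact hM b hb

theorem congruenceSpeed_eventually_of_coprime {a : ℕ} (ha : 2 ≤ a) (h2 : a % 2 = 1)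
    (h5 : ¬ 5 ∣ a) : ∃ M, ∀ b, M ≤ b → congruenceSpeed a b =
      min (padicValNat 2 (a + 1) + padicValNat 2 (a - 1) - 1) (padicValNat 5 (a ^ 4 - 1)) := by
  obtain ⟨M, hM⟩ := eventually_min_arithmetic (N := 2)
    (u := fun b => padicValNat 5 (tetrationGap a b))
    (w := fun b => padicValNat 2 (tetrationGap a b))
    (fun b hb => padicValNat_five_tetrationGap_succ ha h5 hb)
    (fun b hb => padicValNat_two_tetrationGap_succ ha h2 hb)
  rw [min_comm]
  exact congruenceSpeed_eventually_eq ha hM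

/-! ### Evaluating the constants by residue class -/

theorem padicValNat_eq_one_of_dvd_of_not_sq_dvd {p n : ℕ} [Fact p.Prime] (h1 : p ∣ n)
    (h2 : ¬ p ^ 2 ∣ n) : padicValNat p n = 1 := by
  have h0 : n ≠ 0 := by rintro rfl; exact h2 (dvd_zero _)
  have := one_le_padicValNat_of_dvd h0 h1
  rw [padicValNat_dvd_iff_le h0] at h2
  omega

theorem padicValNat_five_pow_four_sub_one {a : ℕ} (ha : 2 ≤ a) : padicValNat 5 (a ^ 4 - 1) =
    padicValNat 5 (a - 1) + padicValNat 5 (a + 1) + padicValNat 5 (a ^ 2 + 1) := by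
  have : Fact (Nat.Prime 5) := ⟨by norm_num⟩
  have h : a ^ 4 - 1 = (a - 1) * (a + 1) * (a ^ 2 + 1) := by
    obtain ⟨c, rfl⟩ := Nat.exists_eq_add_of_le' (show 1 ≤ a by omega)
    rw [Nat.add_sub_cancel]
    exact Nat.sub_eq_of_eq_add (by ring)
  have h1 : (a - 1) * (a + 1) ≠ 0 := mul_ne_zero (by omega) (by omega)
  rw [h, padicValNat.mul h1 (by positivity), padicValNat.mul (by omega) (by omega)]

theorem padicValInt_sub_one {p a : ℕ} (ha : 1 ≤ a) :
    padicValInt p ((a : ℤ) - 1) = padicValNat p (a - 1) := by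
  rw [← padicValInt.of_nat, Nat.cast_sub ha, Nat.cast_one]

theorem padicValInt_add_one {p a : ℕ} : padicValInt p ((a : ℤ) + 1) = padicValNat p (a + 1) := by
  rw [← padicValInt.of_nat, Nat.cast_add, Nat.cast_one]

theorem padicValInt_sq_add_one {p a : ℕ} :
    padicValInt p ((a : ℤ) ^ 2 + 1) = padicValNat p (a ^ 2 + 1) := by
  rw [← padicValInt.of_nat]; push_cast; rfl

theorem padicValInt_sq_sub_one {p a : ℕ} [Fact p.Prime] (ha : 2 ≤ a) :
    padicValInt p ((a : ℤ) ^ 2 - 1) = padicValNat p (a + 1) + padicValNat p (a - 1) := by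
  rw [← padicValInt_sub_one (by omega), ← padicValInt_add_one,
    ← padicValInt.mul (by omega) (by omega)]
  congr 1; ring

theorem five_dvd_sq_add_one_iff {a : ℕ} : 5 ∣ a ^ 2 + 1 ↔ a % 5 = 2 ∨ a % 5 = 3 := by
  have h : a % 5 < 5 := Nat.mod_lt _ (by norm_num)
  rw [Nat.dvd_iff_mod_eq_zero, Nat.add_mod, Nat.pow_mod]
  interval_cases a % 5 <;> simp

theorem twentyFive_dvd_sq_add_one_iff {a : ℕ} :
    25 ∣ a ^ 2 + 1 ↔ a % 25 = 7 ∨ a % 25 = 18 := by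
  have h : a % 25 < 25 := Nat.mod_lt _ (by norm_num)
  rw [Nat.dvd_iff_mod_eq_zero, Nat.add_mod, Nat.pow_mod]
  interval_cases a % 25 <;> simp

/-- Only one of `a - 1`, `a + 1`, `a ^ 2 + 1` is divisible by 5, and 25 divides it only if `a` is a
fourth root of unity mod 25, that is ±1 or ±7. -/
theorem padicValNat_five_pow_four_sub_one_cases {a : ℕ} (ha : 2 ≤ a) (h5 : ¬ 5 ∣ a) :
    (a % 5 = 1 ∧ padicValNat 5 (a ^ 4 - 1) = padicValNat 5 (a - 1) ∧
      (a % 25 = 1 ∨ padicValNat 5 (a - 1) = 1)) ∨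
    (a % 5 = 4 ∧ padicValNat 5 (a ^ 4 - 1) = padicValNat 5 (a + 1) ∧
      (a % 25 = 24 ∨ padicValNat 5 (a + 1) = 1)) ∨
    ((a % 5 = 2 ∨ a % 5 = 3) ∧ padicValNat 5 (a ^ 4 - 1) = padicValNat 5 (a ^ 2 + 1) ∧
      ((a % 25 = 7 ∨ a % 25 = 18) ∨ padicValNat 5 (a ^ 2 + 1) = 1)) := by
  have : Fact (Nat.Prime 5) := ⟨by norm_num⟩
  have z1 : a % 5 ≠ 1 → padicValNat 5 (a - 1) = 0 :=
    fun h => padicValNat.eq_zero_of_not_dvd (by omega)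
  have z2 : a % 5 ≠ 4 → padicValNat 5 (a + 1) = 0 :=
    fun h => padicValNat.eq_zero_of_not_dvd (by omega)
  have z3 : ¬ (a % 5 = 2 ∨ a % 5 = 3) → padicValNat 5 (a ^ 2 + 1) = 0 :=
    fun h => padicValNat.eq_zero_of_not_dvd (by rwa [five_dvd_sq_add_one_iff])
  rw [padicValNat_five_pow_four_sub_one ha]
  have hmod : a % 5 = 1 ∨ a % 5 = 4 ∨ (a % 5 = 2 ∨ a % 5 = 3) := by omega
  rcases hmod with h | h | h
  · refine Or.inl ⟨h, by rw [z2 (by omega), z3 (by omega), add_zero, add_zero],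
      or_iff_not_imp_left.2 fun h' => ?_⟩
    exact padicValNat_eq_one_of_dvd_of_not_sq_dvd (by omega) (by norm_num; omega)
  · refine Or.inr (Or.inl ⟨h, by rw [z1 (by omega), z3 (by omega), zero_add, add_zero],
      or_iff_not_imp_left.2 fun h' => ?_⟩)
    exact padicValNat_eq_one_of_dvd_of_not_sq_dvd (by omega) (by norm_num; omega)
  · refine Or.inr (Or.inr ⟨h, by rw [z1 (by omega), z2 (by omega), zero_add, zero_add], ?_⟩)
    rw [or_iff_not_imp_left]
    exact fun h' => padicValNat_eq_one_of_dvd_of_not_sq_dvd (five_dvd_sq_add_one_iff.2 h)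
      (by rwa [show 5 ^ 2 = 25 by norm_num, twentyFive_dvd_sq_add_one_iff])

/-- One of the two even neighbours of `a` has valuation 1, which cancels the `- 1` in the growth
constant and leaves the valuation of the other. -/
theorem padicValNat_two_add_one_add_sub_one_cases {a : ℕ} (ha : 2 ≤ a) (h2 : a % 2 = 1) :
    (a % 4 = 1 ∧ padicValNat 2 (a + 1) = 1 ∧ 1 ≤ padicValNat 2 (a - 1)) ∨
    (a % 4 = 3 ∧ padicValNat 2 (a - 1) = 1 ∧ 1 ≤ padicValNat 2 (a + 1)) := by
  have hmod : a % 4 = 1 ∨ a % 4 = 3 := by omega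
  rcases hmod with h | h
  · exact Or.inl ⟨h, padicValNat_eq_one_of_dvd_of_not_sq_dvd (by omega) (by norm_num; omega),
      one_le_padicValNat_of_dvd (by omega) (by omega)⟩
  · exact Or.inr ⟨h, padicValNat_eq_one_of_dvd_of_not_sq_dvd (by omega) (by norm_num; omega),
      one_le_padicValNat_of_dvd (by omega) (by omega)⟩

theorem eq_ite_of {α : Type*} {P : Prop} [Decidable P] {x y z : α} (h : P → x = y)
    (h' : ¬ P → x = z) : x = if P then y else z := by
  split_ifs with hP
  exacts [h hP, h' hP]

theorem theorem2p1 (a : ℕ) (ha : a = 0 ∨ ¬ 10 ∣ a) :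
    (∃ b : ℕ, SpeedConstantFrom a b) ∧
    constantCongruenceSpeed a =
      if a = 0 ∨ a = 1 then 0
      else if a % 100 = 1 then
        min (padicValInt 2 ((a : ℤ) - 1)) (padicValInt 5 ((a : ℤ) - 1))
      else if a % 100 = 51 then
        min (padicValInt 2 ((a : ℤ) + 1)) (padicValInt 5 ((a : ℤ) - 1))
      else if a % 10 = 2 ∨ a % 10 = 8 then
        padicValInt 5 ((a : ℤ) ^ 2 + 1)
      else if a % 100 = 7 ∨ a % 100 = 43 then
        min (padicValInt 2 ((a : ℤ) + 1)) (padicValInt 5 ((a : ℤ) ^ 2 + 1))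
      else if a % 100 = 57 ∨ a % 100 = 93 then
        min (padicValInt 2 ((a : ℤ) - 1)) (padicValInt 5 ((a : ℤ) ^ 2 + 1))
      else if a % 10 = 4 then
        padicValInt 5 ((a : ℤ) + 1)
      else if a % 10 = 5 then
        padicValInt 2 ((a : ℤ) ^ 2 - 1) - 1
      else if a % 10 = 6 then
        padicValInt 5 ((a : ℤ) - 1)
      else if a % 100 = 49 then
        min (padicValInt 2 ((a : ℤ) - 1)) (padicValInt 5 ((a : ℤ) + 1))
      else if a % 100 = 99 then
        min (padicValInt 2 ((a : ℤ) + 1)) (padicValInt 5 ((a : ℤ) + 1))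
      else 1 := by
  have : Fact (Nat.Prime 5) := ⟨by norm_num⟩
  suffices h : ∃ M, ∀ b, M ≤ b → congruenceSpeed a b = _ from
    exists_speedConstantFrom_and_eq h.choose_spec
  by_cases h01 : a = 0 ∨ a = 1
  · rw [if_pos h01]
    refine ⟨2, fun b hb => ?_⟩
    have hb1 : b ≠ 1 := by omega
    rcases h01 with rfl | rfl <;> simp [congruenceSpeed, hb1]
  have ha2 : 2 ≤ a := by omega
  have ha10 : ¬ 10 ∣ a := by omega
  rw [if_neg h01, padicValInt_sq_sub_one ha2, padicValInt_sq_add_one]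
  simp only [padicValInt_add_one, padicValInt_sub_one (show 1 ≤ a by omega)]
  rcases Nat.mod_two_eq_zero_or_one a with h2 | h2
  · have h5 : ¬ 5 ∣ a := by omega
    obtain ⟨M, hM⟩ := congruenceSpeed_eventually_of_even ha2 (by omega) h5
    refine ⟨M, fun b hb => (hM b hb).trans ?_⟩
    clear hM
    rcases padicValNat_five_pow_four_sub_one_cases ha2 h5 with
      ⟨h, hv, -⟩ | ⟨h, hv, -⟩ | ⟨h, hv, -⟩
    all_goals
      rw [hv]
      iterate 10 refine eq_ite_of (fun _ => by omega) fun _ => ?_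
      omega
  by_cases h5 : 5 ∣ a
  · obtain ⟨M, hM⟩ := congruenceSpeed_eventually_of_five_dvd ha2 h2 h5
    refine ⟨M, fun b hb => (hM b hb).trans ?_⟩
    iterate 10 refine eq_ite_of (fun _ => by omega) fun _ => ?_
    omega
  · obtain ⟨M, hM⟩ := congruenceSpeed_eventually_of_coprime ha2 h2 h5
    refine ⟨M, fun b hb => (hM b hb).trans ?_⟩
    clear hM
    rcases padicValNat_five_pow_four_sub_one_cases ha2 h5 with
      ⟨h, hv, h'⟩ | ⟨h, hv, h'⟩ | ⟨h, hv, h'⟩ <;>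
    rcases padicValNat_two_add_one_add_sub_one_cases ha2 h2 with ⟨k, kv, k'⟩ | ⟨k, kv, k'⟩
    all_goals
      -- The 2-adic constant is at least 1, so a 5-adic constant equal to 1 decides the minimum.
      have hone : padicValNat 5 (a ^ 4 - 1) = 1 →
          min (padicValNat 2 (a + 1) + padicValNat 2 (a - 1) - 1) (padicValNat 5 (a ^ 4 - 1)) = 1 := by
        clear h h' k
        omega
      rw [hv, kv] at hone ⊢
      iterate 10 refine eq_ite_of (fun _ => by clear hone; omega) fun _ => ?_
      -- A root of unity mod 25 together with the class mod 4 would give one of the residues mod 100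
      -- already excluded.
      refine hone (h'.resolve_left fun h' => ?_)
      omega
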